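/- Let $N\in\mathbb N$, $\mathbb K\in\{\mathbb R,\mathbb C\}$, and let $\mathbb P(\mathbb K^N)$ be the space of polynomials in $N$ variables with coefficients in $\mathbb K$; $\deg P$ denotes the total degree and $D_j=\partial/\partial x_j$. For a norm $q$ on $\mathbb P(\mathbb K^N)$ and $s\ge 0$, say that $q$ satisfies Markov's inequality with exponent $s$ if there is $C>0$ such that $q(D_jP)\le C(\deg P)^s q(P)$ for all $P\in\mathbb P(\mathbb K^N)$ and $1\le j\le N$. Markov's exponent of $q$ is $m(q)=\inf\{s>0: q \text{ satisfies Markov's inequality with exponent } s\}\in[0,\infty]$, where $\inf\emptyset=\infty$. For a multi-index $\alpha\in\mathbb N_0^N$ let $$m(\alpha,q)=\inf\{s>0:\exists C>0\ \forall P\in\mathbb P(\mathbb K^N)\ \ q(D^\alpha P)\le C(\deg P)^s q(P)\}\in[0,\infty],$$ and set $m_k(q)=\max_{|\alpha|=k}m(\alpha,q)$ for $k\ge1$ and $m^*(q)=\limsup_{k\to\infty}\frac1k m_k(q)$. A norm $\sigma$ on $\mathbb P(\mathbb K^N)$ is spectral if $\sigma(P^n)=\sigma(P)^n$ for all $P$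 and $n\ge1$. A norm $q$ has the generalized Nikolskii property (GNP) with the spectral norm $q_\sigma$ if $q_\sigma$ is a spectral norm and there are $A,B>0$ and $a,b\ge0$ such that $q_\sigma(P)\le A(\deg P)^a q(P)$ and $q(P)\le B(\deg P)^b q_\sigma(P)$ for every $P\in\mathbb P(\mathbb K^N)$ with $\deg P\ge1$. A set $E\subset\mathbb R^N$ is uniformly polynomially cuspidal (UPC) if there are $M,m>0$ and an integer $d\ge1$ such that for each $x\in\overline E$ there is a polynomial map $h_x:\mathbb R\to\mathbb R^N$ of degree at most $d$ with $h_x(0)=x$, $h_x((0,1])\subset E$ and $\operatorname{dist}(h_x(t),\mathbb R^N\setminus E)\ge Mt^m$ for all $t\in(0,1]$. For a compact UPC set $E$ and $1\le p<\infty$, let $m(E)$ and $m_p(E)$ be Markov's exponents of the norms $\|P\|_E=\sup_{x\in E}|P(x)|$ and $\|P\|_p=\left(\int_E|P(x)|^p\,dx\right)^{1/p}$ (Lebesgue measure) on $\mathbb P(\mathbb K^N)$. Then the following hold. (a) If a norm $q$ on $\mathbb P(\mathbb K^N)$ has GNP with the spectral norm $q_\sigma$, then $m^*(q)=m(q)$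 if and only if $m(q)=m(q_\sigma)$. (b) If a norm $q$ on $\mathbb P(\mathbb K^N)$ has GNP with the spectral norm $q_\sigma$, $m(q_\sigma)<\infty$, and $q$ satisfies Markov's inequality with exponent $m(q_\sigma)$, then this exponent is the best possible, that is, $q$ does not satisfy Markov's inequality with any exponent $0\le s<m(q_\sigma)$; in particular $m(q)=m(q_\sigma)$. (c) If $E\subset\mathbb R^N$ is a compact UPC set and $1\le p<\infty$, then $m_p(E)\ge m(E)$. -/

import Mathlib

open scoped ENNReal

noncomputable section

namespace MarkovExp

variable {𝕜 : Type*} [RCLike 𝕜] {N : ℕ}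

/-- A seminorm on the space of polynomials in `N` variables that is a norm. -/
def IsNorm (q : Seminorm 𝕜 (MvPolynomial (Fin N) 𝕜)) : Prop :=
  ∀ P, q P = 0 → P = 0

/-- A spectral norm: a norm with `q (P ^ n) = q P ^ n` for all polynomials `P` and `n ≥ 1`. -/
def IsSpectralNorm (q : Seminorm 𝕜 (MvPolynomial (Fin N) 𝕜)) : Prop :=
  IsNorm q ∧ IsPowMul q

/-- The norm `q` has the generalized Nikolskii property (GNP) with the spectral norm `σ`. -/
def HasGNP (q σ : Seminorm 𝕜 (MvPolynomial (Fin N) 𝕜)) : Prop :=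
  IsNorm q ∧ IsSpectralNorm σ ∧
    ∃ A B a b : ℝ, 0 < A ∧ 0 < B ∧ 0 ≤ a ∧ 0 ≤ b ∧
      ∀ P : MvPolynomial (Fin N) 𝕜, 1 ≤ P.totalDegree →
        σ P ≤ A * (P.totalDegree : ℝ) ^ a * q P ∧
        q P ≤ B * (P.totalDegree : ℝ) ^ b * σ P

/-- Markov's inequality with exponent `s` for a nonnegative functional `q` (a norm, in the
cases of interest) on polynomials. -/
def MarkovInequality (q : MvPolynomial (Fin N) 𝕜 → ℝ) (s : ℝ) : Prop :=
  ∃ C : ℝ, 0 < C ∧ ∀ (P : MvPolynomial (Fin N) 𝕜) (j : Fin N),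
    q (MvPolynomial.pderiv j P) ≤ C * (P.totalDegree : ℝ) ^ s * q P

/-- Markov's exponent `m(q) ∈ [0, ∞]`; the infimum of the empty set is `∞`. -/
def markovExponent (q : MvPolynomial (Fin N) 𝕜 → ℝ) : ℝ≥0∞ :=
  sInf (ENNReal.ofReal '' {s : ℝ | 0 < s ∧ MarkovInequality q s})

/-- The partial derivative `D^α = D_1^{α_1} ⋯ D_N^{α_N}`. -/
def multiDeriv (α : Fin N → ℕ) (P : MvPolynomial (Fin N) 𝕜) : MvPolynomial (Fin N) 𝕜 :=
  (List.finRange N).foldr (fun j Q => (MvPolynomial.pderiv j)^[α j] Q) P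

/-- The exponent `m(α, q) ∈ [0, ∞]` of the operator `D^α`. -/
def multiExponent (q : MvPolynomial (Fin N) 𝕜 → ℝ) (α : Fin N → ℕ) : ℝ≥0∞ :=
  sInf (ENNReal.ofReal '' {s : ℝ | 0 < s ∧ ∃ C : ℝ, 0 < C ∧ ∀ P : MvPolynomial (Fin N) 𝕜,
    q (multiDeriv α P) ≤ C * (P.totalDegree : ℝ) ^ s * q P})

/-- `m_k(q)`, the maximum of `m(α, q)` over the (finitely many) `α` with `|α| = k`. -/
def orderExponent (q : MvPolynomial (Fin N) 𝕜 → ℝ) (k : ℕ) : ℝ≥0∞ :=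
  ⨆ (α : Fin N → ℕ) (_ : ∑ j, α j = k), multiExponent q α

/-- The asymptotic exponent `m^*(q)`, the upper limit of `m_k(q) / k`. -/
def asymptoticExponent (q : MvPolynomial (Fin N) 𝕜 → ℝ) : ℝ≥0∞ :=
  Filter.limsup (fun k : ℕ => orderExponent q k / (k : ℝ≥0∞)) Filter.atTop

/-- The value of a polynomial with coefficients in `𝕜` at a real point. -/
def evalReal (P : MvPolynomial (Fin N) 𝕜) (x : EuclideanSpace ℝ (Fin N)) : 𝕜 :=
  MvPolynomial.eval (fun i => (x i : 𝕜)) P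

/-- The supremum norm on `E`. -/
def supNorm (E : Set (EuclideanSpace ℝ (Fin N))) (P : MvPolynomial (Fin N) 𝕜) : ℝ :=
  sSup ((fun x => ‖evalReal P x‖) '' E)

/-- The `L^p` norm on `E` with respect to Lebesgue measure. -/
def lpNormOn (E : Set (EuclideanSpace ℝ (Fin N))) (p : ℝ) (P : MvPolynomial (Fin N) 𝕜) : ℝ :=
  (∫ x in E, ‖evalReal P x‖ ^ p) ^ (1 / p)

/-- The point at parameter `t` of the polynomial curve with components `h`. -/
def polyCurve (h : Fin N → Polynomial ℝ) (t : ℝ) : EuclideanSpace ℝ (Fin N) :=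
  WithLp.toLp 2 (fun i => (h i).eval t)

/-- Uniformly polynomially cuspidal (UPC) sets: uniformly in `x ∈ closure E`, there is a
polynomial curve of bounded degree that starts at `x`, runs in `E` for `0 < t ≤ 1`, and whose
distance from the complement of `E` at the parameter `t` is at least `M * t ^ m`. -/
def IsUPC (E : Set (EuclideanSpace ℝ (Fin N))) : Prop :=
  ∃ (M m : ℝ) (d : ℕ), 0 < M ∧ 0 < m ∧ 1 ≤ d ∧ ∀ x ∈ closure E,
    ∃ h : Fin N → Polynomial ℝ, (∀ i, (h i).natDegree ≤ d) ∧ polyCurve h 0 = x ∧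
      ∀ t ∈ Set.Ioc (0 : ℝ) 1, polyCurve h t ∈ E ∧
        ENNReal.ofReal (M * t ^ m) ≤ Metric.infEDist (polyCurve h t) Eᶜ

end MarkovExp

end

/-! Everything rests on the equality `m^*(q) = m(σ)` for a functional `q` comparable, up to powers
of the degree, with a power-multiplicative seminorm `σ`. Since `m^*(q) ≤ m(q)` always holds
(iterating Markov's inequality `k` times costs at most `k` times the exponent), it yields `m(σ) ≤
m(q)`, and (a) and (b) follow at once.

For the equality, first take `q = σ`. The identity `k! (DP)^k = ∑ (-1)^(k-i) (k choose i) P^(k-i)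
D^k(P^i)` (`alternatingPowerSum_self`) bounds `σ(DP)^k` by `k`-th derivatives of powers of `P`,
because `σ` turns out to be submultiplicative. Since `deg P^i ≤ i deg P`, a bound of order `s` for
each `D_j^k` gives Markov's inequality for `σ` with exponent `s / k`. Hence `m_k(σ) = k m(σ)` for
every `k ≥ 1`. Passing from `σ` to `q` changes `m_k` by at most a constant `a + b`, which disappears
after division by `k` (`asymptoticExponent_eq_markovExponent`).

For (c), the sup norm on a compact set is power-multiplicative and dominates the `L^p` norm up to a
constant. The converse needs a Nikolskii inequality. Chebyshev's extremal property gives it in one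
variable at an end point. Applied along the cuspidal curve, it moves from `x` to a point `y` of `E`
surrounded by a ball in `E` of radius polynomially small in the degree; applied along the rays from
`y`, it bounds `|P(y)|` by the integral over that ball. -/

namespace MarkovExp

/-! ### Powers of a derivative as combinations of higher derivatives of powers -/

section Derivation

variable {A R : Type*} [CommRing A] [CommRing R] [Algebra A R]

/-- The alternating sum `∑ᵢ (-1)^(k-i) (k choose i) P^(k-i) D^m (P^i)`. -/
def alternatingPowerSum (D : Derivation A R R) (P : R) (m k : ℕ) : R :=
  ∑ i ∈ Finset.range (k + 1), (-1) ^ (k - i) * (k.choose i : R) * P ^ (k - i) * D^[m] (P ^ i)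

theorem alternatingPowerSum_zero_succ (D : Derivation A R R) (P : R) (k : ℕ) :
    alternatingPowerSum D P 0 (k + 1) = 0 := by
  have h := add_pow P (-P) (k + 1)
  rw [add_neg_cancel, zero_pow k.succ_ne_zero] at h
  rw [alternatingPowerSum, h]
  refine Finset.sum_congr rfl fun i _ => ?_
  rw [neg_pow P, Function.iterate_zero_apply]
  ring

/-- Leibniz's rule: differentiating the factor `D^m(P^i)` raises `m`, while differentiating
`P^(k+1-i)` lowers `k`, by `(k+1 choose i)(k+1-i) = (k+1)(k choose i)`, and reverses the sign. -/
theorem alternatingPowerSum_succ_succ (D : Derivation A R R) (P : R) (m k : ℕ) :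
    alternatingPowerSum D P (m + 1) (k + 1) =
      D (alternatingPowerSum D P m (k + 1)) + (k + 1) * D P * alternatingPowerSum D P m k := by
  have hD : ∀ i ∈ Finset.range (k + 1 + 1),
      D ((-1) ^ (k + 1 - i) * ((k + 1).choose i : R) * P ^ (k + 1 - i) * D^[m] (P ^ i)) =
      (-1) ^ (k + 1 - i) * ((k + 1).choose i : R) * P ^ (k + 1 - i) * D^[m + 1] (P ^ i) +
      (-1) ^ (k + 1 - i) * (((k + 1).choose i : R) * ((k + 1 - i : ℕ) : R)) *
        P ^ (k + 1 - i - 1) * D P * D^[m] (P ^ i) := by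
    intro i _
    have hc : ((-1) ^ (k + 1 - i) * ((k + 1).choose i : R)) =
        algebraMap A R ((-1) ^ (k + 1 - i) * ((k + 1).choose i : A)) := by simp
    rw [hc, mul_assoc, ← Algebra.smul_def, D.map_smul, D.leibniz, D.leibniz_pow,
      Function.iterate_succ_apply', Algebra.smul_def, ← hc]
    simp only [smul_eq_mul, nsmul_eq_mul]
    ring
  rw [alternatingPowerSum, alternatingPowerSum, alternatingPowerSum, map_sum,
    Finset.sum_congr rfl hD, Finset.sum_add_distrib, add_assoc (Finset.sum _ _), left_eq_add,
    Finset.sum_range_succ _ (k + 1), Finset.mul_sum]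
  simp only [Nat.sub_self, Nat.cast_zero, mul_zero, zero_mul, add_zero]
  rw [← Finset.sum_add_distrib]
  refine Finset.sum_eq_zero fun i hi => ?_
  have hik : i ≤ k := Nat.lt_succ_iff.1 (Finset.mem_range.1 hi)
  have h : ((k + 1).choose i : R) * ((k + 1 - i : ℕ) : R) = (k.choose i : R) * (k + 1) := by
    exact_mod_cast congrArg (Nat.cast (R := R)) (Nat.choose_mul_succ_eq k i).symm
  rw [h, Nat.succ_sub hik, pow_succ, Nat.succ_sub_one]
  ring

/-- The sum is `D^m` of `(P - c)^k`, with `c` treated as a constant and replaced by `P` afterwards;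
fewer than `k` derivatives leave a factor `P - c`. -/
theorem alternatingPowerSum_of_lt (D : Derivation A R R) (P : R) {m k : ℕ} (h : m < k) :
    alternatingPowerSum D P m k = 0 := by
  induction m generalizing k with
  | zero =>
    obtain ⟨k, rfl⟩ := Nat.exists_eq_succ_of_ne_zero h.ne'
    exact alternatingPowerSum_zero_succ D P k
  | succ m ih =>
    obtain ⟨k, rfl⟩ := Nat.exists_eq_succ_of_ne_zero (Nat.ne_of_gt (Nat.zero_lt_of_lt h))
    rw [Nat.succ_eq_add_one, alternatingPowerSum_succ_succ, ih (by omega), ih (by omega)]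
    simp

theorem alternatingPowerSum_self (D : Derivation A R R) (P : R) (k : ℕ) :
    alternatingPowerSum D P k k = (k.factorial : R) * D P ^ k := by
  induction k with
  | zero => simp [alternatingPowerSum]
  | succ k ih =>
    rw [alternatingPowerSum_succ_succ, alternatingPowerSum_of_lt D P k.lt_succ_self, ih,
      Nat.factorial_succ]
    push_cast
    rw [map_zero]
    ring

end Derivation

/-! ### Spectral seminorms are submultiplicative -/

section Spectral

variable {𝕜 R : Type*} [RCLike 𝕜] [CommRing R] [Algebra 𝕜 R]

/-- Polarization reduces a product to squares, on which `σ` is multiplicative. -/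
theorem map_mul_le_two_of_isPowMul {σ : Seminorm 𝕜 R} (hσ : IsPowMul σ) {x y : R}
    (hx : σ x ≤ 1) (hy : σ y ≤ 1) : σ (x * y) ≤ 2 := by
  have h4 : (4 : 𝕜) • (x * y) = (x + y) ^ 2 - (x - y) ^ 2 := by
    rw [Algebra.smul_def, map_ofNat]; ring
  have h := map_sub_le_add σ ((x + y) ^ 2) ((x - y) ^ 2)
  rw [← h4, map_smul_eq_mul, hσ _ one_le_two, hσ _ one_le_two, RCLike.norm_ofNat] at h
  have h1 := map_add_le_add σ x y
  have h2 := map_sub_le_add σ x y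
  nlinarith [apply_nonneg σ (x + y), apply_nonneg σ (x - y)]

/-- The bound 2 also holds for `x^n * y^n`, so all powers of `σ (x * y)` stay below 2. -/
theorem map_mul_le_one_of_isPowMul {σ : Seminorm 𝕜 R} (hσ : IsPowMul σ) {x y : R}
    (hx : σ x ≤ 1) (hy : σ y ≤ 1) : σ (x * y) ≤ 1 := by
  by_contra! h
  obtain ⟨n, hn⟩ := pow_unbounded_of_one_lt 2 h
  rcases n.eq_zero_or_pos with rfl | hn0
  · norm_num at hn
  rw [← hσ _ hn0, mul_pow] at hn
  refine hn.not_ge (map_mul_le_two_of_isPowMul hσ ?_ ?_) <;> rw [hσ _ hn0]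
  · exact pow_le_one₀ (apply_nonneg σ x) hx
  · exact pow_le_one₀ (apply_nonneg σ y) hy

theorem map_mul_le_of_isPowMul {σ : Seminorm 𝕜 R} (hσ : IsPowMul σ) (x y : R) :
    σ (x * y) ≤ σ x * σ y := by
  -- Normalizing by strict upper bounds avoids division by `σ x` or `σ y`, which may vanish.
  have key : ∀ c d : ℝ, σ x < c → σ y < d → σ (x * y) ≤ c * d := by
    intro c d hc hd
    have hc0 : 0 < c := (apply_nonneg σ x).trans_lt hc
    have hd0 : 0 < d := (apply_nonneg σ y).trans_lt hd
    have h := map_mul_le_one_of_isPowMul hσ (x := (c⁻¹ : 𝕜) • x) (y := (d⁻¹ : 𝕜) • y) ?_ ?_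
    · rw [smul_mul_smul_comm, map_smul_eq_mul, norm_mul, norm_inv, norm_inv, RCLike.norm_ofReal,
        RCLike.norm_ofReal, abs_of_pos hc0, abs_of_pos hd0, ← mul_inv,
        inv_mul_le_iff₀ (by positivity), mul_one] at h
      exact h
    · rw [map_smul_eq_mul, norm_inv, RCLike.norm_ofReal, abs_of_pos hc0,
        inv_mul_le_iff₀ hc0, mul_one]
      exact hc.le
    · rw [map_smul_eq_mul, norm_inv, RCLike.norm_ofReal, abs_of_pos hd0,
        inv_mul_le_iff₀ hd0, mul_one]
      exact hd.le
  have hlim : Filter.Tendsto (fun ε : ℝ => (σ x + ε) * (σ y + ε)) (nhdsWithin 0 (Set.Ioi 0))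
      (nhds (σ x * σ y)) := by
    have : Filter.Tendsto (fun ε : ℝ => (σ x + ε) * (σ y + ε)) (nhds 0)
        (nhds ((σ x + 0) * (σ y + 0))) := Continuous.tendsto (by fun_prop) 0
    simpa using this.mono_left nhdsWithin_le_nhds
  refine ge_of_tendsto hlim ?_
  filter_upwards [self_mem_nhdsWithin] with ε hε
  have hε' : 0 < ε := hε
  exact key _ _ (by linarith) (by linarith)

/-- The power of a derivative is controlled by the `k`-th derivatives of powers. -/
theorem factorial_mul_map_derivation_pow_le {σ : Seminorm 𝕜 R} (hσ : IsPowMul σ)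
    (D : Derivation 𝕜 R R) (P : R) {k : ℕ} (hk : 1 ≤ k) :
    (k.factorial : ℝ) * σ (D P) ^ k ≤
      ∑ i ∈ Finset.range (k + 1), (k.choose i : ℝ) * (σ P ^ (k - i) * σ (D^[k] (P ^ i))) := by
  have h0 : (k.factorial : ℝ) * σ (D P) ^ k = σ (alternatingPowerSum D P k k) := by
    have : (k.factorial : R) * D P ^ k = (k.factorial : 𝕜) • D P ^ k := by
      rw [Algebra.smul_def, map_natCast]
    rw [alternatingPowerSum_self, this, map_smul_eq_mul, hσ _ hk, RCLike.norm_natCast]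
  have hpow : ∀ n : ℕ, σ (P ^ n) ≤ σ P ^ n := by
    intro n
    rcases n.eq_zero_or_pos with rfl | hn
    · simpa using IsPowMul.map_one_le_one hσ
    · exact (hσ P hn).le
  rw [h0, alternatingPowerSum]
  refine (Finset.le_sum_of_subadditive σ (map_zero σ).le (map_add_le_add σ) _ _).trans
    (Finset.sum_le_sum fun i _ => ?_)
  have hs : (-1) ^ (k - i) * (k.choose i : R) * P ^ (k - i) * D^[k] (P ^ i) =
      ((-1) ^ (k - i) * (k.choose i : 𝕜)) • (P ^ (k - i) * D^[k] (P ^ i)) := by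
    rw [Algebra.smul_def]; simp [mul_assoc]
  rw [hs, map_smul_eq_mul, norm_mul, norm_pow, norm_neg, norm_one, one_pow, one_mul,
    RCLike.norm_natCast]
  gcongr
  exact (map_mul_le_of_isPowMul hσ _ _).trans
    (mul_le_mul_of_nonneg_right (hpow _) (apply_nonneg σ _))

end Spectral

section Exponents

variable {𝕜 : Type*} [RCLike 𝕜] {N : ℕ}

/-! ### Degrees of derivatives -/

theorem totalDegree_pderiv_le (j : Fin N) (P : MvPolynomial (Fin N) 𝕜) :
    (MvPolynomial.pderiv j P).totalDegree ≤ P.totalDegree := by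
  refine Finset.sup_le fun m hm => ?_
  have h : m + Finsupp.single j 1 ∈ P.support := by
    rw [MvPolynomial.mem_support_iff, MvPolynomial.coeff_pderiv] at hm
    exact MvPolynomial.mem_support_iff.2 fun h => hm (by simp [h])
  refine le_trans ?_ (MvPolynomial.le_totalDegree h)
  rw [Finsupp.sum_add_index' (fun _ => rfl) (fun _ _ _ => rfl)]
  exact Nat.le_add_right _ _

theorem totalDegree_iterate_pderiv_le (j : Fin N) (P : MvPolynomial (Fin N) 𝕜) (k : ℕ) :
    ((MvPolynomial.pderiv j)^[k] P).totalDegree ≤ P.totalDegree := by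
  induction k with
  | zero => exact le_rfl
  | succ k ih =>
    rw [Function.iterate_succ_apply']
    exact (totalDegree_pderiv_le j _).trans ih

theorem totalDegree_foldr_pderiv_le (α : Fin N → ℕ) (P : MvPolynomial (Fin N) 𝕜)
    (l : List (Fin N)) :
    (l.foldr (fun j Q => (MvPolynomial.pderiv j)^[α j] Q) P).totalDegree ≤ P.totalDegree := by
  induction l with
  | nil => exact le_rfl
  | cons j l ih => exact (totalDegree_iterate_pderiv_le j _ _).trans ih

theorem totalDegree_multiDeriv_le (α : Fin N → ℕ) (P : MvPolynomial (Fin N) 𝕜) :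
    (multiDeriv α P).totalDegree ≤ P.totalDegree :=
  totalDegree_foldr_pderiv_le α P _

theorem pderiv_eq_zero_of_totalDegree_eq_zero {P : MvPolynomial (Fin N) 𝕜}
    (hP : P.totalDegree = 0) (j : Fin N) : MvPolynomial.pderiv j P = 0 := by
  rw [MvPolynomial.totalDegree_eq_zero_iff_eq_C.1 hP, MvPolynomial.pderiv_C]

theorem iterate_pderiv_eq_zero_of_totalDegree_eq_zero {P : MvPolynomial (Fin N) 𝕜}
    (hP : P.totalDegree = 0) (j : Fin N) {k : ℕ} (hk : k ≠ 0) :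
    (MvPolynomial.pderiv j)^[k] P = 0 := by
  obtain ⟨k, rfl⟩ := Nat.exists_eq_succ_of_ne_zero hk
  rw [Function.iterate_succ_apply, pderiv_eq_zero_of_totalDegree_eq_zero hP,
    Function.iterate_fixed (map_zero _)]

theorem multiDeriv_eq_zero_of_totalDegree_eq_zero {P : MvPolynomial (Fin N) 𝕜}
    (hP : P.totalDegree = 0) {α : Fin N → ℕ} (hα : α ≠ 0) : multiDeriv α P = 0 := by
  obtain ⟨j, hj⟩ := Function.ne_iff.1 hα
  have key : ∀ l : List (Fin N), j ∈ l →
      l.foldr (fun j Q => (MvPolynomial.pderiv j)^[α j] Q) P = 0 := by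
    intro l
    induction l with
    | nil => simp
    | cons i l ih =>
      intro hjl
      rw [List.foldr_cons]
      by_cases hl : j ∈ l
      · rw [ih hl, Function.iterate_fixed (map_zero _)]
      · obtain rfl : j = i := by simpa [hl] using hjl
        exact iterate_pderiv_eq_zero_of_totalDegree_eq_zero
          (Nat.le_zero.1 ((totalDegree_foldr_pderiv_le α P l).trans hP.le)) _ hj
  exact key _ (List.mem_finRange j)

theorem multiDeriv_single (j : Fin N) (k : ℕ) (P : MvPolynomial (Fin N) 𝕜) :
    multiDeriv (Pi.single j k) P = (MvPolynomial.pderiv j)^[k] P := by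
  have key : ∀ l : List (Fin N), l.Nodup →
      l.foldr (fun i Q => (MvPolynomial.pderiv i)^[(Pi.single j k : Fin N → ℕ) i] Q) P =
        if j ∈ l then (MvPolynomial.pderiv j)^[k] P else P := by
    intro l
    induction l with
    | nil => simp
    | cons i l ih =>
      intro hl
      rw [List.nodup_cons] at hl
      rw [List.foldr_cons, ih hl.2]
      by_cases hij : i = j
      · subst hij
        simp [hl.1]
      · simp [Ne.symm hij]
  rw [multiDeriv, key _ (List.nodup_finRange N), if_pos (List.mem_finRange j)]

/-! ### Exponents as infima of upward closed sets -/

theorem multiExponent_le_ofReal {q : MvPolynomial (Fin N) 𝕜 → ℝ} {α : Fin N → ℕ} {s : ℝ}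
    (hs : 0 < s) (h : ∃ C : ℝ, 0 < C ∧ ∀ P : MvPolynomial (Fin N) 𝕜,
      q (multiDeriv α P) ≤ C * (P.totalDegree : ℝ) ^ s * q P) :
    multiExponent q α ≤ ENNReal.ofReal s :=
  sInf_le ⟨s, ⟨hs, h⟩, rfl⟩

theorem exists_bound_of_multiExponent_lt {q : MvPolynomial (Fin N) 𝕜 → ℝ} (hq0 : q 0 = 0)
    (hq : ∀ P, 0 ≤ q P) {α : Fin N → ℕ} (hα : α ≠ 0) {s : ℝ}
    (h : multiExponent q α < ENNReal.ofReal s) :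
    ∃ C : ℝ, 0 < C ∧ ∀ P : MvPolynomial (Fin N) 𝕜,
      q (multiDeriv α P) ≤ C * (P.totalDegree : ℝ) ^ s * q P := by
  obtain ⟨_, ⟨r, ⟨hr, C, hC, hb⟩, rfl⟩, hrs⟩ := sInf_lt_iff.1 h
  refine ⟨C, hC, fun P => ?_⟩
  rcases Nat.eq_zero_or_pos P.totalDegree with h0 | h1
  · rw [multiDeriv_eq_zero_of_totalDegree_eq_zero h0 hα, hq0]
    have := hq P
    positivity
  · refine (hb P).trans ?_
    have := hq P
    have h1' : (1 : ℝ) ≤ P.totalDegree := by exact_mod_cast h1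
    have := (ENNReal.ofReal_lt_ofReal_iff_of_nonneg hr.le).1 hrs
    gcongr

theorem MarkovInequality.mono {q : MvPolynomial (Fin N) 𝕜 → ℝ} (hq0 : q 0 = 0)
    (hq : ∀ P, 0 ≤ q P) {r s : ℝ} (h : MarkovInequality q r) (hrs : r ≤ s) :
    MarkovInequality q s := by
  obtain ⟨C, hC, hb⟩ := h
  refine ⟨C, hC, fun P j => ?_⟩
  have := hq P
  rcases Nat.eq_zero_or_pos P.totalDegree with h0 | h1
  · rw [pderiv_eq_zero_of_totalDegree_eq_zero h0, hq0]
    positivity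
  · refine (hb P j).trans ?_
    have h1' : (1 : ℝ) ≤ P.totalDegree := by exact_mod_cast h1
    gcongr

theorem MarkovInequality.markovExponent_le {q : MvPolynomial (Fin N) 𝕜 → ℝ} (hq0 : q 0 = 0)
    (hq : ∀ P, 0 ≤ q P) {s : ℝ} (h : MarkovInequality q s) :
    markovExponent q ≤ ENNReal.ofReal s := by
  refine ENNReal.le_of_forall_pos_le_add fun ε hε _ => ?_
  -- The infimum runs over positive exponents only, so `s ≤ 0` is approached from above.
  have hm : 0 < max s 0 + ε := add_pos_of_nonneg_of_pos (le_max_right _ _) hε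
  refine (sInf_le ⟨max s 0 + ε, ⟨hm, h.mono hq0 hq ?_⟩, rfl⟩ :
    markovExponent q ≤ ENNReal.ofReal (max s 0 + ε)).trans ?_
  · exact (le_max_left _ _).trans (le_add_of_nonneg_right ε.2)
  · rw [ENNReal.ofReal_add (le_max_right _ _) NNReal.zero_le_coe, ENNReal.ofReal_coe_nnreal]
    simp [ENNReal.ofReal_max]

/-! ### Iterating Markov's inequality -/

theorem map_multiDeriv_le {q : MvPolynomial (Fin N) 𝕜 → ℝ} (hq : ∀ P, 0 ≤ q P) {s C : ℝ}
    (hs : 0 ≤ s) (hC : 0 < C)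
    (h : ∀ (P : MvPolynomial (Fin N) 𝕜) (j : Fin N),
      q (MvPolynomial.pderiv j P) ≤ C * (P.totalDegree : ℝ) ^ s * q P)
    (α : Fin N → ℕ) (P : MvPolynomial (Fin N) 𝕜) :
    q (multiDeriv α P) ≤ (C * (P.totalDegree : ℝ) ^ s) ^ (∑ j, α j) * q P := by
  have iter : ∀ (j : Fin N) (k : ℕ) (Q : MvPolynomial (Fin N) 𝕜),
      Q.totalDegree ≤ P.totalDegree →
      q ((MvPolynomial.pderiv j)^[k] Q) ≤ (C * (P.totalDegree : ℝ) ^ s) ^ k * q Q := by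
    intro j k Q hQ
    induction k with
    | zero => simp
    | succ k ih =>
      have hd : (((MvPolynomial.pderiv j)^[k] Q).totalDegree : ℝ) ≤ P.totalDegree := by
        exact_mod_cast (totalDegree_iterate_pderiv_le j Q k).trans hQ
      rw [Function.iterate_succ_apply', pow_succ', mul_assoc]
      refine (h _ j).trans ?_
      have := hq ((MvPolynomial.pderiv j)^[k] Q)
      gcongr
  have key : ∀ l : List (Fin N),
      q (l.foldr (fun j Q => (MvPolynomial.pderiv j)^[α j] Q) P) ≤
        (C * (P.totalDegree : ℝ) ^ s) ^ (l.map α).sum * q P := by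
    intro l
    induction l with
    | nil => simp
    | cons j l ih =>
      rw [List.foldr_cons, List.map_cons, List.sum_cons, pow_add, mul_assoc]
      refine (iter j (α j) _ (totalDegree_foldr_pderiv_le α P l)).trans ?_
      gcongr
  have := key (List.finRange N)
  rwa [← List.ofFn_eq_map, List.sum_ofFn] at this

theorem orderExponent_le_mul_markovExponent {q : MvPolynomial (Fin N) 𝕜 → ℝ}
    (hq : ∀ P, 0 ≤ q P) {k : ℕ} (hk : 1 ≤ k) :
    orderExponent q k ≤ k * markovExponent q := by
  refine iSup₂_le fun α hα => ?_
  have hk0 : (k : ℝ≥0∞) ≠ 0 := by exact_mod_cast (Nat.one_le_iff_ne_zero.1 hk)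
  rw [← ENNReal.div_le_iff' hk0 (ENNReal.natCast_ne_top k)]
  refine le_sInf ?_
  rintro _ ⟨s, ⟨hs, C, hC, h⟩, rfl⟩
  rw [ENNReal.div_le_iff' hk0 (ENNReal.natCast_ne_top k), ← ENNReal.ofReal_natCast,
    ← ENNReal.ofReal_mul (Nat.cast_nonneg k)]
  have hk' : (0 : ℝ) < k := by exact_mod_cast hk
  refine multiExponent_le_ofReal (by positivity) ⟨C ^ k, by positivity, fun P => ?_⟩
  refine (map_multiDeriv_le hq hs.le hC h α P).trans_eq ?_
  rw [hα, mul_pow, ← Real.rpow_mul_natCast (Nat.cast_nonneg _), mul_comm s]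

/-- The hypothesis is applied to the powers `P^i`, `i ≤ k`, whose degree exceeds that of `P` by a
factor of at most `i`; the `k`-th root of the resulting bound on `σ(D_j P)^k` turns `s` into `s /
k`. -/
theorem MarkovInequality.of_iterate_pderiv {σ : Seminorm 𝕜 (MvPolynomial (Fin N) 𝕜)}
    (hσ : IsPowMul σ) {k : ℕ} (hk : 1 ≤ k) {s : ℝ} (hs : 0 < s)
    (h : ∀ j : Fin N, ∃ C : ℝ, 0 < C ∧ ∀ P : MvPolynomial (Fin N) 𝕜,
      σ ((MvPolynomial.pderiv j)^[k] P) ≤ C * (P.totalDegree : ℝ) ^ s * σ P) :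
    MarkovInequality σ (s / k) := by
  choose C hC hb using h
  have hk' : (0 : ℝ) < k := by exact_mod_cast hk
  -- Summing over `j` gives one constant valid for all variables.
  set K : ℝ := ∑ j, C j * ∑ i ∈ Finset.range (k + 1), (k.choose i : ℝ) * (i : ℝ) ^ s
  have hS : 0 ≤ ∑ i ∈ Finset.range (k + 1), (k.choose i : ℝ) * (i : ℝ) ^ s :=
    Finset.sum_nonneg fun i _ => by positivity
  have hK : 0 ≤ K := Finset.sum_nonneg fun j _ => mul_nonneg (hC j).le hS
  refine ⟨K ^ (1 / (k : ℝ)) + 1, by positivity, fun P j => ?_⟩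
  set n : ℝ := (P.totalDegree : ℝ)
  have hn : 0 ≤ n := Nat.cast_nonneg _
  have hσP := apply_nonneg σ P
  have hterm : ∀ i ∈ Finset.range (k + 1),
      (k.choose i : ℝ) * (σ P ^ (k - i) * σ ((MvPolynomial.pderiv j)^[k] (P ^ i))) ≤
        C j * ((k.choose i : ℝ) * (i : ℝ) ^ s) * (n ^ s * σ P ^ k) := by
    intro i hi
    have hik : i ≤ k := Nat.lt_succ_iff.1 (Finset.mem_range.1 hi)
    rcases i.eq_zero_or_pos with rfl | hi0
    · rw [pow_zero, iterate_pderiv_eq_zero_of_totalDegree_eq_zero MvPolynomial.totalDegree_one j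
        (Nat.one_le_iff_ne_zero.1 hk), map_zero, mul_zero, mul_zero]
      have := (hC j).le
      positivity
    · have hdeg : ((P ^ i).totalDegree : ℝ) ≤ i * n := by
        simp only [n]
        exact_mod_cast MvPolynomial.totalDegree_pow P i
      have h1 : σ ((MvPolynomial.pderiv j)^[k] (P ^ i)) ≤ C j * (i * n) ^ s * σ P ^ i := by
        refine (hb j (P ^ i)).trans ?_
        rw [hσ P hi0]
        have := (hC j).le
        gcongr
      calc (k.choose i : ℝ) * (σ P ^ (k - i) * σ ((MvPolynomial.pderiv j)^[k] (P ^ i)))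
          ≤ (k.choose i : ℝ) * (σ P ^ (k - i) * (C j * (i * n) ^ s * σ P ^ i)) := by gcongr
        _ = C j * ((k.choose i : ℝ) * (i : ℝ) ^ s) * (n ^ s * (σ P ^ (k - i) * σ P ^ i)) := by
          rw [Real.mul_rpow (Nat.cast_nonneg i) hn]; ring
        _ = _ := by rw [← pow_add, Nat.sub_add_cancel hik]
  have hpow : σ (MvPolynomial.pderiv j P) ^ k ≤ K * (n ^ s * σ P ^ k) := by
    calc σ (MvPolynomial.pderiv j P) ^ k
        ≤ (k.factorial : ℝ) * σ (MvPolynomial.pderiv j P) ^ k :=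
          le_mul_of_one_le_left (by positivity) (by exact_mod_cast k.factorial_pos)
      _ ≤ _ := factorial_mul_map_derivation_pow_le hσ (MvPolynomial.pderiv j) P hk
      _ ≤ _ := Finset.sum_le_sum hterm
      _ = C j * (∑ i ∈ Finset.range (k + 1), (k.choose i : ℝ) * (i : ℝ) ^ s) *
          (n ^ s * σ P ^ k) := by rw [← Finset.sum_mul, ← Finset.mul_sum]
      _ ≤ _ := by
        refine mul_le_mul_of_nonneg_right ?_ (by positivity)
        exact Finset.single_le_sum
          (f := fun j => C j * ∑ i ∈ Finset.range (k + 1), (k.choose i : ℝ) * (i : ℝ) ^ s)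
          (fun j _ => mul_nonneg (hC j).le hS) (Finset.mem_univ j)
  have hroot : (K ^ (1 / (k : ℝ)) * n ^ (s / k) * σ P) ^ k = K * (n ^ s * σ P ^ k) := by
    rw [mul_pow, mul_pow, ← Real.rpow_mul_natCast hK, ← Real.rpow_mul_natCast hn,
      one_div_mul_cancel hk'.ne', div_mul_cancel₀ _ hk'.ne', Real.rpow_one, mul_assoc]
  rw [← hroot] at hpow
  refine (le_of_pow_le_pow_left₀ (Nat.one_le_iff_ne_zero.1 hk) (by positivity) hpow).trans ?_
  gcongr
  exact le_add_of_nonneg_right zero_le_one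

theorem mul_markovExponent_le_orderExponent {σ : Seminorm 𝕜 (MvPolynomial (Fin N) 𝕜)}
    (hσ : IsPowMul σ) {k : ℕ} (hk : 1 ≤ k) :
    k * markovExponent σ ≤ orderExponent σ k := by
  refine le_of_forall_gt_imp_ge_of_dense fun c hc => ?_
  rcases eq_or_ne c ∞ with rfl | hct
  · exact le_top
  have hk' : (0 : ℝ) < k := by exact_mod_cast hk
  have hs : 0 < c.toReal := ENNReal.toReal_pos (zero_le.trans_lt hc).ne' hct
  have hM : MarkovInequality σ (c.toReal / k) := by
    refine .of_iterate_pderiv hσ hk hs fun j => ?_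
    simp_rw [← multiDeriv_single]
    refine exists_bound_of_multiExponent_lt (map_zero σ) (apply_nonneg σ) ?_ ?_
    · exact fun h => (Nat.one_le_iff_ne_zero.1 hk) (by simpa using congrFun h j)
    · rw [ENNReal.ofReal_toReal hct]
      exact (le_iSup₂ (f := fun (α : Fin N → ℕ) (_ : ∑ j, α j = k) => multiExponent σ α)
        (Pi.single j k) (by simp)).trans_lt hc
  calc (k : ℝ≥0∞) * markovExponent σ
      ≤ k * ENNReal.ofReal (c.toReal / k) := by
        gcongr; exact hM.markovExponent_le (map_zero σ) (apply_nonneg σ)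
    _ = c := by
        rw [← ENNReal.ofReal_natCast, ← ENNReal.ofReal_mul (Nat.cast_nonneg k),
          mul_div_cancel₀ _ hk'.ne', ENNReal.ofReal_toReal hct]

/-! ### Functionals comparable up to a power of the degree -/

/-- `q₁` is bounded by `q₂` times a multiple of the power `a` of the degree plus one. -/
def DegreeDominated (q₁ q₂ : MvPolynomial (Fin N) 𝕜 → ℝ) (a : ℝ) : Prop :=
  ∃ A : ℝ, 0 < A ∧ ∀ P : MvPolynomial (Fin N) 𝕜,
    q₁ P ≤ A * ((P.totalDegree : ℝ) + 1) ^ a * q₂ P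

/-- Each comparison is used once, whatever the order of `α`, and `D^α` does not raise the degree; so
the loss `a + b` is independent of `|α|`. -/
theorem multiExponent_le_add {q₁ q₂ : MvPolynomial (Fin N) 𝕜 → ℝ} (h0 : q₁ 0 = 0)
    (hq₁ : ∀ P, 0 ≤ q₁ P) (hq₂ : ∀ P, 0 ≤ q₂ P) {a b : ℝ} (ha : 0 ≤ a) (hb : 0 ≤ b)
    (h₁₂ : DegreeDominated q₁ q₂ a) (h₂₁ : DegreeDominated q₂ q₁ b)
    {α : Fin N → ℕ} (hα : α ≠ 0) :
    multiExponent q₁ α ≤ multiExponent q₂ α + ENNReal.ofReal (a + b) := by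
  obtain ⟨A, hA, h₁₂⟩ := h₁₂
  obtain ⟨B, hB, h₂₁⟩ := h₂₁
  rw [multiExponent, multiExponent, ENNReal.sInf_add]
  refine le_iInf₂ ?_
  rintro _ ⟨s, ⟨hs, C, hC, h⟩, rfl⟩
  rw [← ENNReal.ofReal_add hs.le (add_nonneg ha hb)]
  refine multiExponent_le_ofReal (by positivity)
    ⟨A * 2 ^ a * C * (B * 2 ^ b), by positivity, fun P => ?_⟩
  have hP₁ := hq₁ P
  have hP₂ := hq₂ P
  rcases Nat.eq_zero_or_pos P.totalDegree with hd | hd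
  · rw [multiDeriv_eq_zero_of_totalDegree_eq_zero hd hα, h0]
    positivity
  have hn : (1 : ℝ) ≤ P.totalDegree := by exact_mod_cast hd
  set n : ℝ := (P.totalDegree : ℝ)
  have hn0 : 0 < n := one_pos.trans_le hn
  have hm : ((multiDeriv α P).totalDegree : ℝ) ≤ n :=
    Nat.cast_le.2 (totalDegree_multiDeriv_le α P)
  have := hq₂ (multiDeriv α P)
  calc q₁ (multiDeriv α P)
      ≤ A * (((multiDeriv α P).totalDegree : ℝ) + 1) ^ a * q₂ (multiDeriv α P) := h₁₂ _
    _ ≤ A * (2 * n) ^ a * (C * n ^ s * (B * (2 * n) ^ b * q₁ P)) := by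
        gcongr
        · linarith
        · refine (h P).trans ?_
          gcongr
          refine (h₂₁ P).trans ?_
          gcongr
          linarith
    _ = _ := by
        rw [Real.mul_rpow zero_le_two hn0.le, Real.mul_rpow zero_le_two hn0.le,
          Real.rpow_add hn0, Real.rpow_add hn0]
        ring

theorem orderExponent_le_add {q₁ q₂ : MvPolynomial (Fin N) 𝕜 → ℝ} (h0 : q₁ 0 = 0)
    (hq₁ : ∀ P, 0 ≤ q₁ P) (hq₂ : ∀ P, 0 ≤ q₂ P) {a b : ℝ} (ha : 0 ≤ a) (hb : 0 ≤ b)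
    (h₁₂ : DegreeDominated q₁ q₂ a) (h₂₁ : DegreeDominated q₂ q₁ b) {k : ℕ} (hk : 1 ≤ k) :
    orderExponent q₁ k ≤ orderExponent q₂ k + ENNReal.ofReal (a + b) := by
  refine iSup₂_le fun α hα => ?_
  refine (multiExponent_le_add h0 hq₁ hq₂ ha hb h₁₂ h₂₁ ?_).trans ?_
  · rintro rfl
    simp at hα
    omega
  · gcongr
    exact le_iSup₂ (f := fun (α : Fin N → ℕ) (_ : ∑ j, α j = k) => multiExponent q₂ α) α hα

theorem tendsto_const_div_natCast_atTop {c : ℝ≥0∞} (hc : c ≠ ∞) :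
    Filter.Tendsto (fun k : ℕ => c / (k : ℝ≥0∞)) Filter.atTop (nhds 0) := by
  simpa [div_eq_mul_inv] using
    ENNReal.Tendsto.const_mul ENNReal.tendsto_inv_nat_nhds_zero (Or.inr hc)

/-- The Markov exponent of a spectral seminorm is the asymptotic exponent of every functional
comparable with it. -/
theorem asymptoticExponent_eq_markovExponent {q : MvPolynomial (Fin N) 𝕜 → ℝ}
    {σ : Seminorm 𝕜 (MvPolynomial (Fin N) 𝕜)} (hσ : IsPowMul σ) (h0 : q 0 = 0)
    (hq : ∀ P, 0 ≤ q P) {a b : ℝ} (ha : 0 ≤ a) (hb : 0 ≤ b)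
    (hσq : DegreeDominated σ q a) (hqσ : DegreeDominated q σ b) :
    asymptoticExponent q = markovExponent σ := by
  set c : ℝ≥0∞ := ENNReal.ofReal (a + b)
  have hlim := tendsto_const_div_natCast_atTop (c := c) ENNReal.ofReal_ne_top
  refine le_antisymm ?_ ?_
  · have h1 : ∀ᶠ k : ℕ in Filter.atTop,
        orderExponent q k / (k : ℝ≥0∞) ≤ markovExponent σ + c / k := by
      filter_upwards [Filter.eventually_ge_atTop 1] with k hk
      have hk0 : (k : ℝ≥0∞) ≠ 0 := by exact_mod_cast (Nat.one_le_iff_ne_zero.1 hk)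
      rw [ENNReal.div_le_iff' hk0 (ENNReal.natCast_ne_top k), mul_add,
        ENNReal.mul_div_cancel hk0 (ENNReal.natCast_ne_top k)]
      refine (orderExponent_le_add h0 hq (apply_nonneg σ) hb ha hqσ hσq hk).trans ?_
      rw [add_comm b a]
      gcongr
      exact orderExponent_le_mul_markovExponent (apply_nonneg σ) hk
    refine (Filter.limsup_le_limsup h1).trans_eq ?_
    simpa using (tendsto_const_nhds.add hlim).limsup_eq
  · have h2 : ∀ᶠ k : ℕ in Filter.atTop,
        markovExponent σ ≤ orderExponent q k / (k : ℝ≥0∞) + c / k := by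
      filter_upwards [Filter.eventually_ge_atTop 1] with k hk
      have hk0 : (k : ℝ≥0∞) ≠ 0 := by exact_mod_cast (Nat.one_le_iff_ne_zero.1 hk)
      rw [← ENNReal.add_div, ENNReal.le_div_iff_mul_le (Or.inl hk0)
        (Or.inl (ENNReal.natCast_ne_top k)), mul_comm]
      exact (mul_markovExponent_le_orderExponent hσ hk).trans
        (orderExponent_le_add (map_zero σ) (apply_nonneg σ) hq ha hb hσq hqσ hk)
    calc markovExponent σ = Filter.limsup (fun _ : ℕ => markovExponent σ) Filter.atTop := by simp
      _ ≤ _ := Filter.limsup_le_limsup h2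
      _ = _ := ENNReal.limsup_add_of_right_tendsto_zero hlim _

theorem asymptoticExponent_le_markovExponent {q : MvPolynomial (Fin N) 𝕜 → ℝ}
    (hq : ∀ P, 0 ≤ q P) : asymptoticExponent q ≤ markovExponent q := by
  refine Filter.limsup_le_of_le (by isBoundedDefault) ?_
  filter_upwards [Filter.eventually_ge_atTop 1] with k hk
  have hk0 : (k : ℝ≥0∞) ≠ 0 := by exact_mod_cast (Nat.one_le_iff_ne_zero.1 hk)
  rw [ENNReal.div_le_iff' hk0 (ENNReal.natCast_ne_top k)]
  exact orderExponent_le_mul_markovExponent hq hk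

/-! ### The generalized Nikolskii property -/

theorem degreeDominated_of_one_le {q₁ q₂ : Seminorm 𝕜 (MvPolynomial (Fin N) 𝕜)}
    (h2 : q₂ 1 ≠ 0) {A a : ℝ} (hA : 0 < A) (ha : 0 ≤ a)
    (h : ∀ P : MvPolynomial (Fin N) 𝕜, 1 ≤ P.totalDegree →
      q₁ P ≤ A * (P.totalDegree : ℝ) ^ a * q₂ P) : DegreeDominated q₁ q₂ a := by
  have h2' : 0 < q₂ 1 := (apply_nonneg q₂ 1).lt_of_ne' h2
  have h1' := apply_nonneg q₁ 1
  refine ⟨A + q₁ 1 / q₂ 1, by positivity, fun P => ?_⟩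
  have hP := apply_nonneg q₂ P
  -- On constants the two seminorms are proportional, with ratio `q₁ 1 / q₂ 1`.
  rcases Nat.eq_zero_or_pos P.totalDegree with hd | hd
  · have hC : P = (MvPolynomial.coeff 0 P) • (1 : MvPolynomial (Fin N) 𝕜) := by
      rw [MvPolynomial.smul_eq_C_mul, mul_one]
      exact MvPolynomial.totalDegree_eq_zero_iff_eq_C.1 hd
    have hq : q₁ P = q₁ 1 / q₂ 1 * q₂ P := by
      rw [hC, map_smul_eq_mul, map_smul_eq_mul]
      field_simp
    rw [hd, Nat.cast_zero, zero_add, Real.one_rpow, mul_one, hq, add_mul]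
    exact le_add_of_nonneg_left (by positivity)
  · refine (h P hd).trans ?_
    gcongr
    · exact le_add_of_nonneg_right (by positivity)
    · linarith

theorem HasGNP.exists_degreeDominated {q σ : Seminorm 𝕜 (MvPolynomial (Fin N) 𝕜)}
    (h : HasGNP q σ) : ∃ a b : ℝ, 0 ≤ a ∧ 0 ≤ b ∧ DegreeDominated σ q a ∧
      DegreeDominated q σ b := by
  obtain ⟨hq, hσ, A, B, a, b, hA, hB, ha, hb, h⟩ := h
  exact ⟨a, b, ha, hb,
    degreeDominated_of_one_le (fun h => one_ne_zero (hq 1 h)) hA ha fun P hP => (h P hP).1,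
    degreeDominated_of_one_le (fun h => one_ne_zero (hσ.1 1 h)) hB hb fun P hP => (h P hP).2⟩

theorem HasGNP.asymptoticExponent_eq {q σ : Seminorm 𝕜 (MvPolynomial (Fin N) 𝕜)}
    (h : HasGNP q σ) : asymptoticExponent q = markovExponent σ := by
  obtain ⟨a, b, ha, hb, hσq, hqσ⟩ := h.exists_degreeDominated
  exact asymptoticExponent_eq_markovExponent h.2.1.2 (map_zero q) (apply_nonneg q) ha hb hσq hqσ

theorem HasGNP.markovExponent_le {q σ : Seminorm 𝕜 (MvPolynomial (Fin N) 𝕜)}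
    (h : HasGNP q σ) : markovExponent σ ≤ markovExponent q :=
  h.asymptoticExponent_eq ▸ asymptoticExponent_le_markovExponent (apply_nonneg q)

theorem HasGNP.asymptoticExponent_eq_markovExponent_iff
    {q σ : Seminorm 𝕜 (MvPolynomial (Fin N) 𝕜)} (h : HasGNP q σ) :
    asymptoticExponent q = markovExponent q ↔ markovExponent q = markovExponent σ := by
  rw [h.asymptoticExponent_eq, eq_comm]

theorem HasGNP.not_markovInequality_of_lt {q σ : Seminorm 𝕜 (MvPolynomial (Fin N) 𝕜)}
    (h : HasGNP q σ) {s : ℝ} (hs : 0 ≤ s) (hlt : s < (markovExponent σ).toReal) :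
    ¬ MarkovInequality q s := fun hM => by
  have h1 := h.markovExponent_le.trans (hM.markovExponent_le (map_zero q) (apply_nonneg q))
  have h2 := ENNReal.toReal_mono ENNReal.ofReal_ne_top h1
  rw [ENNReal.toReal_ofReal hs] at h2
  exact hlt.not_ge h2

theorem HasGNP.markovExponent_eq {q σ : Seminorm 𝕜 (MvPolynomial (Fin N) 𝕜)}
    (h : HasGNP q σ) (hσ : markovExponent σ ≠ ∞)
    (hM : MarkovInequality q (markovExponent σ).toReal) :
    markovExponent q = markovExponent σ := by
  refine le_antisymm ?_ h.markovExponent_le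
  simpa [ENNReal.ofReal_toReal hσ] using hM.markovExponent_le (map_zero q) (apply_nonneg q)

end Exponents

/-! ### Nikolskii inequalities at an end point of an interval -/

section Univariate

open Polynomial

theorem exists_derivative_eq (g : ℝ[X]) {n : ℕ} (hg : g.natDegree ≤ n) :
    ∃ F : ℝ[X], derivative F = g ∧ F.natDegree ≤ n + 1 := by
  refine ⟨∑ i ∈ Finset.range (n + 1), monomial (i + 1) (g.coeff i / (i + 1)), ?_, ?_⟩
  · rw [map_sum]
    conv_rhs => rw [g.as_sum_range' (n + 1) (Nat.lt_succ_of_le hg)]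
    refine Finset.sum_congr rfl fun i _ => ?_
    have : ((i : ℝ) + 1) ≠ 0 := by positivity
    rw [derivative_monomial, Nat.add_sub_cancel, Nat.cast_succ, div_mul_cancel₀ _ this]
  · refine natDegree_sum_le_of_forall_le _ _ fun i hi => (natDegree_monomial_le _).trans ?_
    exact Finset.mem_range.1 hi

/-- The value of `f` is the derivative of a primitive of degree at most `n + 1`, whose oscillation
is controlled by the integral of `|f|`; Markov's inequality at an end point then applies. -/
theorem eval_zero_le_integral_abs (f : ℝ[X]) {n : ℕ} (hf : f.natDegree ≤ n) :
    f.eval 0 ≤ 2 * ((n : ℝ) + 1) ^ 2 * ∫ t in (0 : ℝ)..1, |f.eval t| := by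
  set I := ∫ t in (0 : ℝ)..1, |f.eval t|
  have hI : 0 ≤ I := intervalIntegral.integral_nonneg zero_le_one fun _ _ => abs_nonneg _
  -- The substitution carries `[-1, 1]` onto `[0, 1]` with `1` going to `0`.
  set g : ℝ[X] := f.comp (C (1 / 2) - C (1 / 2) * X)
  have hgeval : ∀ x, g.eval x = f.eval (1 / 2 - 1 / 2 * x) := fun x => by simp [g]
  have hlin : (C (1 / 2) - C (1 / 2) * X : ℝ[X]).natDegree ≤ 1 := by compute_degree
  have hgd : g.natDegree ≤ n := by
    refine natDegree_comp_le.trans ?_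
    calc _ ≤ n * 1 := Nat.mul_le_mul hf hlin
      _ = n := mul_one n
  obtain ⟨F, hF, hFd⟩ := exists_derivative_eq g hgd
  have hbound : ∀ x ∈ Set.Icc (-1 : ℝ) 1, |F.eval x - F.eval 1| ≤ 2 * I := by
    intro x hx
    have h1 : ∫ t in x..1, g.eval t = F.eval 1 - F.eval x := by
      refine intervalIntegral.integral_eq_sub_of_hasDerivAt (f := fun t => F.eval t)
        (fun t _ => ?_) (g.continuous.intervalIntegrable _ _)
      simpa [hF] using F.hasDerivAt t
    have h2 : ∫ t in (-1 : ℝ)..1, |g.eval t| = 2 * I := by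
      simp_rw [hgeval]
      rw [intervalIntegral.integral_comp_sub_mul (fun y => |f.eval y|) (by norm_num)]
      norm_num [I]
    rw [abs_sub_comm, ← h1, ← h2]
    refine (intervalIntegral.abs_integral_le_integral_abs hx.2).trans ?_
    exact intervalIntegral.integral_mono_interval hx.1 hx.2 le_rfl
      (Filter.Eventually.of_forall fun _ => abs_nonneg _)
      ((g.continuous.abs).intervalIntegrable _ _)
  have key : ∀ c : ℝ, 2 * I < c → f.eval 0 ≤ ((n : ℝ) + 1) ^ 2 * c := by
    intro c hc
    have hc0 : 0 < c := by linarith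
    have hdeg : (C c⁻¹ * (F - C (F.eval 1))).degree ≤ ((n + 1 : ℕ) : WithBot ℕ) := by
      refine natDegree_le_iff_degree_le.1 ?_
      refine (natDegree_C_mul_le _ _).trans ?_
      rwa [natDegree_sub_C]
    -- Among polynomials of degree at most `n + 1` bounded by 1 on `[-1, 1]`, the Chebyshev
    -- polynomial has the largest derivative at 1, namely `(n + 1)^2`. The strict `c > 2 * I`
    -- permits normalization even if `I = 0`.
    have h := Chebyshev.eval_iterate_derivative_le_of_forall_abs_le_one (k := 1) le_rfl hdeg
      (fun x hx => by
        rw [eval_mul, eval_C, eval_sub, eval_C, abs_mul, abs_of_pos (inv_pos.2 hc0),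
          inv_mul_le_iff₀ hc0, mul_one]
        exact (hbound x hx).trans hc.le)
    rw [Function.iterate_one, Chebyshev.T_derivative_eq_U] at h
    simp only [derivative_C_mul, derivative_sub, derivative_C, sub_zero, hF, eval_mul, eval_C,
      hgeval, Chebyshev.U_eval_one, eval_intCast] at h
    push_cast at h
    rw [inv_mul_le_iff₀ hc0] at h
    norm_num at h
    linarith
  by_contra! hlt
  have hn : (0 : ℝ) < ((n : ℝ) + 1) ^ 2 := by positivity
  have h1 : 2 * I < f.eval 0 / ((n : ℝ) + 1) ^ 2 := by
    rw [lt_div_iff₀ hn]; linarith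
  obtain ⟨c, hc1, hc2⟩ := exists_between h1
  rw [lt_div_iff₀ hn] at hc2
  linarith [key c hc1]

variable {𝕜 : Type*} [RCLike 𝕜]

theorem continuous_norm_eval (f : 𝕜[X]) : Continuous fun t : ℝ => ‖f.eval (t : 𝕜)‖ :=
  (f.continuous.comp RCLike.continuous_ofReal).norm

/-- Nikolskii's inequality at an end point of the unit interval. -/
theorem norm_eval_zero_le_integral (f : 𝕜[X]) {n : ℕ} (hf : f.natDegree ≤ n) :
    ‖f.eval 0‖ ≤ 2 * ((n : ℝ) + 1) ^ 2 * ∫ t in (0 : ℝ)..1, ‖f.eval (t : 𝕜)‖ := by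
  obtain ⟨c, hc1, hc⟩ := RCLike.exists_norm_eq_mul_self (f.eval 0)
  -- On the real line `g` is the real part of `c f`, where the unimodular `c` rotates `f(0)` to
  -- `‖f(0)‖`.
  set g : ℝ[X] := ∑ i ∈ Finset.range (n + 1), C (RCLike.re (c * f.coeff i)) * X ^ i
  have hg : ∀ t : ℝ, g.eval t = RCLike.re (c * f.eval (t : 𝕜)) := by
    intro t
    rw [eval_eq_sum_range' (Nat.lt_succ_of_le hf), Finset.mul_sum, map_sum, eval_finsetSum]
    refine Finset.sum_congr rfl fun i _ => ?_
    rw [eval_mul, eval_C, eval_pow, eval_X, ← mul_assoc, ← RCLike.ofReal_pow, RCLike.re_mul_ofReal]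
  have hgd : g.natDegree ≤ n := natDegree_sum_le_of_forall_le _ _ fun i hi =>
    (natDegree_C_mul_X_pow_le _ _).trans (Nat.lt_succ_iff.1 (Finset.mem_range.1 hi))
  have h0 : ‖f.eval 0‖ = g.eval 0 := by
    rw [hg, RCLike.ofReal_zero, ← hc, RCLike.ofReal_re]
  rw [h0]
  refine (eval_zero_le_integral_abs g hgd).trans ?_
  refine mul_le_mul_of_nonneg_left ?_ (by positivity)
  refine intervalIntegral.integral_mono_on zero_le_one (g.continuous.abs.intervalIntegrable _ _)
    ((continuous_norm_eval f).intervalIntegrable _ _) fun t _ => ?_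
  rw [hg]
  refine (RCLike.abs_re_le_norm _).trans_eq ?_
  rw [norm_mul, hc1, one_mul]

/-- The end point estimate is rescaled to `[x, 1]`, whose length is at least `1/2`; this doubles the
constant. -/
theorem norm_eval_le_integral (f : 𝕜[X]) {n : ℕ} (hf : f.natDegree ≤ n) {x : ℝ} (hx0 : 0 ≤ x)
    (hx : x ≤ 1 / 2) :
    ‖f.eval (x : 𝕜)‖ ≤ 4 * ((n : ℝ) + 1) ^ 2 * ∫ t in (0 : ℝ)..1, ‖f.eval (t : 𝕜)‖ := by
  set g : 𝕜[X] := f.comp (C (x : 𝕜) + C ((1 - x : ℝ) : 𝕜) * X)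
  have hlin : (C (x : 𝕜) + C ((1 - x : ℝ) : 𝕜) * X : 𝕜[X]).natDegree ≤ 1 := by compute_degree
  have hgd : g.natDegree ≤ n := by
    refine natDegree_comp_le.trans ?_
    calc _ ≤ n * 1 := Nat.mul_le_mul hf hlin
      _ = n := mul_one n
  have hg : ∀ t : ℝ, g.eval (t : 𝕜) = f.eval ((x + (1 - x) * t : ℝ) : 𝕜) := fun t => by
    simp [g]
  have hx1 : 0 < 1 - x := by linarith
  have h := norm_eval_zero_le_integral g hgd
  rw [← RCLike.ofReal_zero] at h
  simp_rw [hg] at h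
  rw [intervalIntegral.integral_comp_add_mul (fun y : ℝ => ‖f.eval (y : 𝕜)‖) hx1.ne'] at h
  simp only [mul_zero, add_zero, mul_one, add_sub_cancel, smul_eq_mul] at h
  have hI : ∫ t in x..1, ‖f.eval (t : 𝕜)‖ ≤ ∫ t in (0 : ℝ)..1, ‖f.eval (t : 𝕜)‖ :=
    intervalIntegral.integral_mono_interval hx0 (by linarith) le_rfl
      (Filter.Eventually.of_forall fun _ => norm_nonneg _)
      ((continuous_norm_eval f).intervalIntegrable _ _)
  have hI0 : 0 ≤ ∫ t in x..1, ‖f.eval (t : 𝕜)‖ :=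
    intervalIntegral.integral_nonneg (by linarith) fun _ _ => norm_nonneg _
  have hinv : (1 - x)⁻¹ ≤ 2 := by
    rw [inv_le_comm₀ hx1 two_pos]; linarith
  calc _ ≤ _ := h
    _ ≤ 2 * ((n : ℝ) + 1) ^ 2 * (2 * ∫ t in (0 : ℝ)..1, ‖f.eval (t : 𝕜)‖) := by gcongr
    _ = _ := by ring

theorem le_one_eighth {n : ℕ} {δ : ℝ} (hδ0 : 0 ≤ δ) (hδ : 8 * ((n : ℝ) + 1) ^ 2 * δ ≤ 1) :
    δ ≤ 1 / 8 := by
  have h1 : (1 : ℝ) ≤ ((n : ℝ) + 1) ^ 2 :=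
    one_le_pow₀ (le_add_of_nonneg_left (Nat.cast_nonneg n))
  nlinarith [mul_le_mul_of_nonneg_right h1 hδ0]

/-- Nikolskii's inequality at the origin for an interval that omits a short piece next to it. -/
theorem norm_eval_zero_le_integral_of_le (f : 𝕜[X]) {n : ℕ} (hf : f.natDegree ≤ n) {δ : ℝ}
    (hδ0 : 0 ≤ δ) (hδ : 8 * ((n : ℝ) + 1) ^ 2 * δ ≤ 1) :
    ‖f.eval 0‖ ≤ 4 * ((n : ℝ) + 1) ^ 2 * ∫ t in δ..1, ‖f.eval (t : 𝕜)‖ := by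
  have hint : ∀ a b : ℝ, IntervalIntegrable (fun t : ℝ => ‖f.eval (t : 𝕜)‖)
      MeasureTheory.volume a b :=
    fun a b => (continuous_norm_eval f).intervalIntegrable _ _
  have hδ2 : δ ≤ 1 / 8 := le_one_eighth hδ0 hδ
  have hsplit := intervalIntegral.integral_add_adjacent_intervals (hint 0 δ) (hint δ 1)
  set I := ∫ t in (0 : ℝ)..1, ‖f.eval (t : 𝕜)‖
  have hI : 0 ≤ I := intervalIntegral.integral_nonneg zero_le_one fun _ _ => norm_nonneg _
  have h1 : ∫ t in (0 : ℝ)..δ, ‖f.eval (t : 𝕜)‖ ≤ ∫ _ in (0 : ℝ)..δ, 4 * ((n : ℝ) + 1) ^ 2 * I :=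
    intervalIntegral.integral_mono_on hδ0 (hint _ _) (by simp) fun t ht =>
      norm_eval_le_integral f hf ht.1 (by linarith [ht.2])
  rw [intervalIntegral.integral_const, smul_eq_mul, sub_zero] at h1
  -- By the pointwise bound, `[0, δ]` carries at most half of the integral, so `[δ, 1]` carries at
  -- least half.
  have h2 : δ * (4 * ((n : ℝ) + 1) ^ 2 * I) ≤ I / 2 := by nlinarith
  have h3 : I ≤ 2 * ∫ t in δ..1, ‖f.eval (t : 𝕜)‖ := by linarith
  calc _ ≤ _ := norm_eval_zero_le_integral f hf
    _ ≤ 2 * ((n : ℝ) + 1) ^ 2 * (2 * ∫ t in δ..1, ‖f.eval (t : 𝕜)‖) := by gcongr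
    _ = _ := by ring

theorem exists_norm_eval_zero_le (f : 𝕜[X]) {n : ℕ} (hf : f.natDegree ≤ n) {δ : ℝ}
    (hδ0 : 0 ≤ δ) (hδ : 8 * ((n : ℝ) + 1) ^ 2 * δ ≤ 1) :
    ∃ t ∈ Set.Icc δ 1, ‖f.eval 0‖ ≤ 4 * ((n : ℝ) + 1) ^ 2 * ‖f.eval (t : 𝕜)‖ := by
  have hδ1 : δ ≤ 1 := (le_one_eighth hδ0 hδ).trans (by norm_num)
  obtain ⟨t, ht, hmax⟩ := isCompact_Icc.exists_isMaxOn (Set.nonempty_Icc.2 hδ1)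
    (continuous_norm_eval f).continuousOn
  refine ⟨t, ht, (norm_eval_zero_le_integral_of_le f hf hδ0 hδ).trans ?_⟩
  gcongr
  calc _ ≤ ∫ _ in δ..1, ‖f.eval (t : 𝕜)‖ :=
        intervalIntegral.integral_mono_on hδ1 ((continuous_norm_eval f).intervalIntegrable _ _)
          (by simp) fun s hs => hmax hs
    _ ≤ _ := by
      rw [intervalIntegral.integral_const, smul_eq_mul]
      exact mul_le_of_le_one_left (norm_nonneg _) (by linarith)

end Univariate

/-! ### Nikolskii inequalities on balls and on UPC sets -/

section Nikolskii

open MeasureTheory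
open scoped Pointwise

variable {𝕜 : Type*} [RCLike 𝕜] {N : ℕ}

theorem continuous_evalReal (P : MvPolynomial (Fin N) 𝕜) : Continuous (evalReal P) :=
  (MvPolynomial.continuous_eval P).comp <| continuous_pi fun i =>
    RCLike.continuous_ofReal.comp (EuclideanSpace.proj (𝕜 := ℝ) i).continuous

theorem exists_eval_eq_evalReal_polyCurve (P : MvPolynomial (Fin N) 𝕜) {n : ℕ}
    (hP : P.totalDegree ≤ n) (h : Fin N → Polynomial ℝ) {d : ℕ} (hd : ∀ i, (h i).natDegree ≤ d) :
    ∃ f : Polynomial 𝕜, f.natDegree ≤ n * d ∧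
      ∀ t : ℝ, f.eval (t : 𝕜) = evalReal P (polyCurve h t) := by
  refine ⟨MvPolynomial.aeval (fun i => (h i).map (algebraMap ℝ 𝕜)) P,
    MvPolynomial.aeval_natDegree_le P hP _ fun i => Polynomial.natDegree_map_le.trans (hd i),
    fun t => ?_⟩
  rw [evalReal, ← Polynomial.coe_evalRingHom, MvPolynomial.aeval_def,
    MvPolynomial.hom_eval₂, MvPolynomial.eval, MvPolynomial.coe_eval₂Hom]
  congr 1
  · ext c; simp [Polynomial.algebraMap_eq]
  · ext i
    simp only [Polynomial.coe_evalRingHom, polyCurve]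
    rw [← RCLike.algebraMap_eq_ofReal, Polynomial.eval_map, Polynomial.eval₂_at_apply]

/-- A mean value estimate for polynomials on balls, with a polynomial factor in the degree. -/
theorem measureReal_closedBall_mul_norm_evalReal_le (P : MvPolynomial (Fin N) 𝕜) {n : ℕ}
    (hP : P.totalDegree ≤ n) (y : EuclideanSpace ℝ (Fin N)) (r : ℝ) {δ : ℝ}
    (hδ0 : 0 < δ) (hδ : 8 * ((n : ℝ) + 1) ^ 2 * δ ≤ 1) :
    volume.real (Metric.closedBall (0 : EuclideanSpace ℝ (Fin N)) r) * ‖evalReal P y‖ ≤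
      4 * ((n : ℝ) + 1) ^ 2 *
        ((δ ^ N)⁻¹ * ∫ w in Metric.closedBall 0 r, ‖evalReal P (y + w)‖) := by
  set B := Metric.closedBall (0 : EuclideanSpace ℝ (Fin N)) r
  set g : EuclideanSpace ℝ (Fin N) → ℝ := fun w => ‖evalReal P (y + w)‖
  have hg : Continuous g := ((continuous_evalReal P).comp (continuous_const_add y)).norm
  have hg0 : ∀ w, 0 ≤ g w := fun w => norm_nonneg _
  have hB : IsCompact B := isCompact_closedBall 0 r
  have hδ1 : δ ≤ 1 := (le_one_eighth hδ0.le hδ).trans (by norm_num)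
  -- The one-variable inequality on the segment from `y` to `y + v`. Omitting `t < δ` keeps the
  -- Jacobian `t^(-N)` of the later substitution `w = t • v` below `δ^(-N)`.
  have hline : ∀ v, ‖evalReal P y‖ ≤
      4 * ((n : ℝ) + 1) ^ 2 * ∫ t in Set.Ioc δ 1, g (t • v) := by
    intro v
    obtain ⟨f, hfd, hf⟩ := exists_eval_eq_evalReal_polyCurve P hP
      (fun i => Polynomial.C (y i) + Polynomial.C (v i) * Polynomial.X) (d := 1)
      (fun i => by compute_degree)
    have hc : ∀ t : ℝ, polyCurve
        (fun i => Polynomial.C (y i) + Polynomial.C (v i) * Polynomial.X) t = y + t • v := by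
      intro t
      ext i
      simp only [polyCurve, Polynomial.eval_add, Polynomial.eval_mul, Polynomial.eval_C,
        Polynomial.eval_X, PiLp.add_apply, PiLp.smul_apply, smul_eq_mul, mul_comm t]
    have h := norm_eval_zero_le_integral_of_le f (hfd.trans_eq (mul_one n)) hδ0.le hδ
    rw [← RCLike.ofReal_zero] at h
    simp_rw [hf, hc] at h
    rwa [zero_smul, add_zero, intervalIntegral.integral_of_le hδ1] at h
  have hint : Integrable (Function.uncurry fun (v : EuclideanSpace ℝ (Fin N)) (t : ℝ) => g (t • v))
      ((volume.restrict B).prod (volume.restrict (Set.Ioc δ 1))) := by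
    rw [Measure.prod_restrict]
    have hc : Continuous
        (Function.uncurry fun (v : EuclideanSpace ℝ (Fin N)) (t : ℝ) => g (t • v)) :=
      hg.comp (continuous_snd.smul continuous_fst)
    exact (hc.continuousOn.integrableOn_compact (hB.prod isCompact_Icc)).mono_set
      (Set.prod_mono_right Set.Ioc_subset_Icc_self)
  have hscale : ∀ t ∈ Set.Ioc δ 1, ∫ v in B, g (t • v) ≤ (δ ^ N)⁻¹ * ∫ w in B, g w := by
    intro t ht
    have ht0 : 0 < t := hδ0.trans ht.1
    rw [Measure.setIntegral_comp_smul_of_pos volume g B ht0, finrank_euclideanSpace_fin,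
      smul_eq_mul]
    have hsub : t • B ⊆ B := by
      rintro _ ⟨v, hv, rfl⟩
      rw [mem_closedBall_zero_iff] at hv ⊢
      simp only [norm_smul, Real.norm_of_nonneg ht0.le]
      exact (mul_le_of_le_one_left (norm_nonneg v) ht.2).trans hv
    have hmono : ∫ w in t • B, g w ≤ ∫ w in B, g w :=
      setIntegral_mono_set (hg.continuousOn.integrableOn_compact hB)
        (Filter.Eventually.of_forall hg0) hsub.eventuallyLE
    refine mul_le_mul ?_ hmono (integral_nonneg hg0) (by positivity)
    gcongr
    exact ht.1.le
  calc volume.real B * ‖evalReal P y‖ = ∫ _ in B, ‖evalReal P y‖ := by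
        rw [setIntegral_const, smul_eq_mul]
    _ ≤ ∫ v in B, 4 * ((n : ℝ) + 1) ^ 2 * ∫ t in Set.Ioc δ 1, g (t • v) :=
        integral_mono (integrableOn_const hB.measure_lt_top.ne)
          (hint.integral_prod_left.const_mul _) hline
    _ = 4 * ((n : ℝ) + 1) ^ 2 * ∫ t in Set.Ioc δ 1, ∫ v in B, g (t • v) := by
        rw [integral_const_mul, integral_integral_swap hint]
    _ ≤ 4 * ((n : ℝ) + 1) ^ 2 * ∫ _ in Set.Ioc δ 1, (δ ^ N)⁻¹ * ∫ w in B, g w := by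
        gcongr ?_ * ?_
        exact setIntegral_mono_on hint.integral_prod_right (integrableOn_const (by simp))
          measurableSet_Ioc hscale
    _ ≤ _ := by
        rw [setIntegral_const, smul_eq_mul, Real.volume_real_Ioc_of_le hδ1]
        have : 0 ≤ ∫ w in B, g w := integral_nonneg hg0
        refine mul_le_mul_of_nonneg_left ?_ (by positivity)
        exact mul_le_of_le_one_left (by positivity) (by linarith)

theorem closedBall_subset_of_le_infEDist {E : Set (EuclideanSpace ℝ (Fin N))}
    {y : EuclideanSpace ℝ (Fin N)} {r ρ : ℝ} (hr : r < ρ)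
    (h : ENNReal.ofReal ρ ≤ Metric.infEDist y Eᶜ) : Metric.closedBall y r ⊆ E := by
  intro z hz
  by_contra hzE
  have h1 := h.trans (Metric.infEDist_le_edist_of_mem hzE)
  rw [edist_dist, ENNReal.ofReal_le_ofReal_iff dist_nonneg, dist_comm] at h1
  exact (hr.trans_le h1).not_ge (Metric.mem_closedBall.1 hz)

/-- A Nikolskii inequality between the supremum norm and the `L¹` norm on a UPC set. -/
theorem IsUPC.exists_norm_evalReal_le_integral {E : Set (EuclideanSpace ℝ (Fin N))}
    (hE : IsCompact E) (hU : IsUPC E) :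
    ∃ A a : ℝ, 0 < A ∧ 0 ≤ a ∧ ∀ (P : MvPolynomial (Fin N) 𝕜), ∀ x ∈ E,
      ‖evalReal P x‖ ≤ A * ((P.totalDegree : ℝ) + 1) ^ a * ∫ z in E, ‖evalReal P z‖ := by
  obtain ⟨M, m, d, hM, hm, hd, hU⟩ := hU
  set ω : ℝ := volume.real (Metric.closedBall (0 : EuclideanSpace ℝ (Fin N)) 1)
  have hω : 0 < ω := ENNReal.toReal_pos
    (Metric.measure_closedBall_pos volume _ one_pos).ne' measure_closedBall_lt_top.ne
  -- Exponent of `w` in the final bound: one factor from the curve, one from the rays, `w^N` from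
  -- `δ^(-N)` with `δ = 1/w`, and `w^(m * N)` from the volume of the ball.
  set κ : ℝ := 2 + N + m * N
  have hκ : 0 ≤ κ := by positivity
  have hd0 : (0 : ℝ) < d := by exact_mod_cast hd
  refine ⟨(2 / M) ^ N * ω⁻¹ * (8 * (d : ℝ) ^ 2) ^ κ, 2 * κ, by positivity, by positivity,
    fun P x hx => ?_⟩
  obtain ⟨h, hhd, hh0, hh⟩ := hU x (subset_closure hx)
  set n := P.totalDegree
  obtain ⟨f, hfd, hf⟩ := exists_eval_eq_evalReal_polyCurve P le_rfl h hhd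
  set D := n * d
  have hnD : n ≤ D := Nat.le_mul_of_pos_right n hd
  set w : ℝ := 8 * ((D : ℝ) + 1) ^ 2
  have hw : 0 < w := by positivity
  have hδ : w * w⁻¹ ≤ 1 := (mul_inv_cancel₀ hw.ne').le
  obtain ⟨t, ht, hft⟩ := exists_norm_eval_zero_le f hfd (inv_pos.2 hw).le hδ
  have ht0 : 0 < t := (inv_pos.2 hw).trans_le ht.1
  rw [← RCLike.ofReal_zero, hf, hf, hh0] at hft
  obtain ⟨-, hdist⟩ := hh t ⟨ht0, ht.2⟩
  set y := polyCurve h t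
  -- Since `t ≥ 1/w`, the distance from `y` to the complement is at least `M * w^(-m)`; halving it
  -- makes the closed ball lie in `E`.
  set r : ℝ := M / 2 * (w ^ m)⁻¹
  have hr : 0 < r := by positivity
  have hrt : r < M * t ^ m := by
    have h1 : (w ^ m)⁻¹ ≤ t ^ m := by
      rw [← Real.inv_rpow hw.le]
      exact Real.rpow_le_rpow (inv_pos.2 hw).le ht.1 hm.le
    have h2 : 0 < M * t ^ m := by positivity
    have h3 : r ≤ M / 2 * t ^ m := by
      simp only [r]
      gcongr
    linarith
  have hball : Metric.closedBall y r ⊆ E :=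
    closedBall_subset_of_le_infEDist hrt hdist
  have hmean := measureReal_closedBall_mul_norm_evalReal_le P hnD y r (inv_pos.2 hw) hδ
  have hI : ∫ v in Metric.closedBall 0 r, ‖evalReal P (y + v)‖ ≤ ∫ z in E, ‖evalReal P z‖ := by
    have hpre : (fun v => y + v) ⁻¹' Metric.closedBall y r = Metric.closedBall 0 r := by
      ext v; simp
    rw [← hpre, (measurePreserving_add_left volume y).setIntegral_preimage_emb
      (measurableEmbedding_addLeft y) (fun z => ‖evalReal P z‖)]
    exact setIntegral_mono_set ((continuous_evalReal P).norm.continuousOn.integrableOn_compact hE)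
      (Filter.Eventually.of_forall fun _ => norm_nonneg _) hball.eventuallyLE
  set I := ∫ z in E, ‖evalReal P z‖
  have hI0 : 0 ≤ I := integral_nonneg fun _ => norm_nonneg _
  have hvol : volume.real (Metric.closedBall (0 : EuclideanSpace ℝ (Fin N)) r) = r ^ N * ω := by
    rw [Measure.addHaar_real_closedBall' volume _ hr.le, finrank_euclideanSpace_fin]
  rw [hvol] at hmean
  have hL : 4 * ((D : ℝ) + 1) ^ 2 ≤ w := by simp only [w]; nlinarith [sq_nonneg ((D : ℝ) + 1)]
  have hy : ‖evalReal P y‖ ≤ (r ^ N * ω)⁻¹ * (w * (w ^ N * I)) := by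
    rw [inv_mul_eq_div, le_div_iff₀' (by positivity)]
    refine hmean.trans ?_
    rw [inv_pow, inv_inv]
    gcongr
  have hwle : w ≤ 8 * (d : ℝ) ^ 2 * ((n : ℝ) + 1) ^ 2 := by
    have h1 : (1 : ℝ) ≤ d := by exact_mod_cast hd
    have : (D : ℝ) + 1 ≤ d * ((n : ℝ) + 1) := by
      simp only [D]; push_cast; nlinarith
    calc w ≤ 8 * (d * ((n : ℝ) + 1)) ^ 2 := by simp only [w]; gcongr
      _ = _ := by ring
  have hrinv : (r ^ N)⁻¹ = (2 / M) ^ N * w ^ (m * N) := by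
    rw [Real.rpow_mul_natCast hw.le, ← mul_pow, ← inv_pow]
    simp only [r]
    rw [mul_inv, inv_inv, inv_div]
  calc ‖evalReal P x‖ ≤ w * ((r ^ N * ω)⁻¹ * (w * (w ^ N * I))) := by
        refine hft.trans ?_
        gcongr
    _ = (2 / M) ^ N * ω⁻¹ * w ^ κ * I := by
        rw [mul_inv, hrinv, Real.rpow_add hw, Real.rpow_add hw, Real.rpow_natCast, Real.rpow_two]
        ring
    _ ≤ (2 / M) ^ N * ω⁻¹ * (8 * (d : ℝ) ^ 2 * ((n : ℝ) + 1) ^ 2) ^ κ * I := by gcongr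
    _ = _ := by
        rw [Real.mul_rpow (by positivity) (by positivity), ← Real.rpow_natCast ((n : ℝ) + 1) 2,
          ← Real.rpow_mul (by positivity)]
        push_cast
        ring

/-- Hölder's inequality against the constant 1; `p = 1`, which has no finite conjugate exponent, is
separate. -/
theorem setIntegral_le_rpow_setIntegral_rpow {X : Type*} [TopologicalSpace X] [T2Space X]
    [MeasurableSpace X] [OpensMeasurableSpace X] {μ : Measure X} [IsFiniteMeasureOnCompacts μ]
    {E : Set X} (hE : IsCompact E) {g : X → ℝ} (hg : Continuous g)
    (hg0 : ∀ x, 0 ≤ g x) {p : ℝ} (hp : 1 ≤ p) :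
    ∫ x in E, g x ∂μ ≤ μ.real E ^ (1 - 1 / p) * (∫ x in E, g x ^ p ∂μ) ^ (1 / p) := by
  rcases hp.eq_or_lt with rfl | hp1
  · simp
  have : IsFiniteMeasure (μ.restrict E) := ⟨by simpa using hE.measure_lt_top⟩
  have hpq : p.HolderConjugate p.conjExponent := .conjExponent hp1
  obtain ⟨K, hK⟩ := hE.exists_bound_of_continuousOn hg.continuousOn
  have hmem : MemLp g (ENNReal.ofReal p) (μ.restrict E) := by
    refine .of_bound ((hg.continuousOn.integrableOn_compact hE).aestronglyMeasurable) K ?_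
    exact (ae_restrict_iff' hE.measurableSet).2 (Filter.Eventually.of_forall hK)
  have h := integral_mul_le_Lp_mul_Lq_of_nonneg hpq (Filter.Eventually.of_forall hg0)
    (Filter.Eventually.of_forall fun _ => zero_le_one) hmem (memLp_const (1 : ℝ))
  simp only [mul_one, Real.one_rpow, integral_const, smul_eq_mul, measureReal_restrict_apply_univ]
    at h
  have hq : 1 - 1 / p = 1 / p.conjExponent := by
    rw [one_div, one_div, ← hpq.one_sub_inv]
  rw [hq, mul_comm]
  exact h

/-! ### The supremum norm as a spectral seminorm -/

theorem bddAbove_norm_evalReal {E : Set (EuclideanSpace ℝ (Fin N))} (hE : IsCompact E)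
    (P : MvPolynomial (Fin N) 𝕜) : BddAbove ((fun x => ‖evalReal P x‖) '' E) :=
  hE.bddAbove_image (continuous_evalReal P).norm.continuousOn

theorem norm_evalReal_le_supNorm {E : Set (EuclideanSpace ℝ (Fin N))} (hE : IsCompact E)
    (P : MvPolynomial (Fin N) 𝕜) {x : EuclideanSpace ℝ (Fin N)} (hx : x ∈ E) :
    ‖evalReal P x‖ ≤ supNorm E P :=
  le_csSup (bddAbove_norm_evalReal hE P) ⟨x, hx, rfl⟩

theorem supNorm_nonneg (E : Set (EuclideanSpace ℝ (Fin N))) (P : MvPolynomial (Fin N) 𝕜) :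
    0 ≤ supNorm E P :=
  Real.sSup_nonneg (by rintro _ ⟨x, _, rfl⟩; exact norm_nonneg _)

theorem supNorm_le {E : Set (EuclideanSpace ℝ (Fin N))} {P : MvPolynomial (Fin N) 𝕜} {c : ℝ}
    (hc : 0 ≤ c) (h : ∀ x ∈ E, ‖evalReal P x‖ ≤ c) : supNorm E P ≤ c :=
  Real.sSup_le (by rintro _ ⟨x, hx, rfl⟩; exact h x hx) hc

/-- The supremum norm on a compact set as a seminorm on polynomials. -/
noncomputable def supSeminorm {E : Set (EuclideanSpace ℝ (Fin N))} (hE : IsCompact E) :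
    Seminorm 𝕜 (MvPolynomial (Fin N) 𝕜) :=
  .ofSMulLE (supNorm E)
    (le_antisymm (supNorm_le le_rfl fun x _ => by simp [evalReal]) (supNorm_nonneg E 0))
    (fun P Q => supNorm_le (add_nonneg (supNorm_nonneg E P) (supNorm_nonneg E Q)) fun x hx => by
      rw [evalReal, map_add]
      exact (norm_add_le _ _).trans
        (add_le_add (norm_evalReal_le_supNorm hE P hx) (norm_evalReal_le_supNorm hE Q hx)))
    (fun c P => supNorm_le (mul_nonneg (norm_nonneg c) (supNorm_nonneg E P)) fun x hx => by
      rw [evalReal, MvPolynomial.smul_eval, norm_mul]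
      exact mul_le_mul_of_nonneg_left (norm_evalReal_le_supNorm hE P hx) (norm_nonneg c))

theorem supSeminorm_apply {E : Set (EuclideanSpace ℝ (Fin N))} (hE : IsCompact E)
    (P : MvPolynomial (Fin N) 𝕜) : supSeminorm hE P = supNorm E P := rfl

theorem isPowMul_supSeminorm {E : Set (EuclideanSpace ℝ (Fin N))} (hE : IsCompact E) :
    IsPowMul (supSeminorm (𝕜 := 𝕜) hE) := by
  intro P n hn
  simp only [supSeminorm_apply]
  have hpow : ∀ x, ‖evalReal (P ^ n) x‖ = ‖evalReal P x‖ ^ n := fun x => by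
    rw [evalReal, map_pow, norm_pow, evalReal]
  refine le_antisymm (supNorm_le (pow_nonneg (supNorm_nonneg E P) n) fun x hx => ?_) ?_
  · rw [hpow]
    exact pow_le_pow_left₀ (norm_nonneg _) (norm_evalReal_le_supNorm hE P hx) n
  · have hn0 : n ≠ 0 := Nat.one_le_iff_ne_zero.1 hn
    have h0 := supNorm_nonneg E (P ^ n)
    have hle : supNorm E P ≤ supNorm E (P ^ n) ^ ((n : ℝ)⁻¹) := by
      refine supNorm_le (by positivity) fun x hx => ?_
      rw [← Real.pow_rpow_inv_natCast (norm_nonneg (evalReal P x)) hn0, ← hpow]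
      exact Real.rpow_le_rpow (norm_nonneg _) (norm_evalReal_le_supNorm hE _ hx) (by positivity)
    calc supNorm E P ^ n ≤ (supNorm E (P ^ n) ^ ((n : ℝ)⁻¹)) ^ n :=
          pow_le_pow_left₀ (supNorm_nonneg E P) hle n
      _ = _ := Real.rpow_inv_natCast_pow h0 hn0

/-! ### The `L^p` norm -/

theorem lpNormOn_nonneg (E : Set (EuclideanSpace ℝ (Fin N))) (p : ℝ)
    (P : MvPolynomial (Fin N) 𝕜) : 0 ≤ lpNormOn E p P :=
  Real.rpow_nonneg (integral_nonneg fun _ => Real.rpow_nonneg (norm_nonneg _) _) _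

theorem lpNormOn_zero (E : Set (EuclideanSpace ℝ (Fin N))) {p : ℝ} (hp : 0 < p) :
    lpNormOn E p (0 : MvPolynomial (Fin N) 𝕜) = 0 := by
  have : ∀ x, evalReal (0 : MvPolynomial (Fin N) 𝕜) x = 0 := fun x => by simp [evalReal]
  simp [lpNormOn, this, Real.zero_rpow hp.ne', Real.zero_rpow (inv_pos.2 hp).ne']

theorem degreeDominated_lpNormOn_supNorm {E : Set (EuclideanSpace ℝ (Fin N))} (hE : IsCompact E)
    {p : ℝ} (hp : 0 < p) :
    DegreeDominated (𝕜 := 𝕜) (lpNormOn E p) (supNorm E) 0 := by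
  refine ⟨volume.real E ^ (1 / p) + 1, by positivity, fun P => ?_⟩
  have h0 := supNorm_nonneg E P
  have hcont : Continuous fun x => ‖evalReal P x‖ ^ p :=
    (continuous_evalReal P).norm.rpow_const fun _ => Or.inr hp.le
  have hI : ∫ x in E, ‖evalReal P x‖ ^ p ≤ volume.real E * supNorm E P ^ p := by
    rw [← smul_eq_mul, ← setIntegral_const]
    refine setIntegral_mono_on (hcont.continuousOn.integrableOn_compact hE)
      (integrableOn_const hE.measure_lt_top.ne) hE.measurableSet fun x hx => ?_
    exact Real.rpow_le_rpow (norm_nonneg _) (norm_evalReal_le_supNorm hE P hx) hp.le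
  have hI0 : 0 ≤ ∫ x in E, ‖evalReal P x‖ ^ p :=
    integral_nonneg fun _ => Real.rpow_nonneg (norm_nonneg _) _
  rw [Real.rpow_zero, mul_one]
  calc lpNormOn E p P ≤ (volume.real E * supNorm E P ^ p) ^ (1 / p) :=
        Real.rpow_le_rpow hI0 hI (by positivity)
    _ = volume.real E ^ (1 / p) * supNorm E P := by
        rw [Real.mul_rpow measureReal_nonneg (by positivity), ← Real.rpow_mul h0,
          mul_one_div_cancel hp.ne', Real.rpow_one]
    _ ≤ _ := by gcongr; exact le_add_of_nonneg_right zero_le_one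

theorem IsUPC.exists_degreeDominated_supNorm_lpNormOn {E : Set (EuclideanSpace ℝ (Fin N))}
    (hE : IsCompact E) (hU : IsUPC E) {p : ℝ} (hp : 1 ≤ p) :
    ∃ a : ℝ, 0 ≤ a ∧ DegreeDominated (𝕜 := 𝕜) (supNorm E) (lpNormOn E p) a := by
  obtain ⟨A, a, hA, ha, h⟩ := hU.exists_norm_evalReal_le_integral (𝕜 := 𝕜) hE
  refine ⟨a, ha, A * (volume.real E ^ (1 - 1 / p) + 1), by positivity, fun P => ?_⟩
  have hq := lpNormOn_nonneg E p P
  refine supNorm_le (by positivity) fun x hx => (h P x hx).trans ?_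
  have hH := setIntegral_le_rpow_setIntegral_rpow (μ := volume) hE (continuous_evalReal P).norm
    (fun _ => norm_nonneg _) hp
  calc A * ((P.totalDegree : ℝ) + 1) ^ a * ∫ z in E, ‖evalReal P z‖
      ≤ A * ((P.totalDegree : ℝ) + 1) ^ a *
          ((volume.real E ^ (1 - 1 / p) + 1) * lpNormOn E p P) := by
        gcongr
        refine hH.trans (mul_le_mul_of_nonneg_right ?_ hq)
        exact le_add_of_nonneg_right zero_le_one
    _ = _ := by ring

theorem IsUPC.markovExponent_supNorm_le {E : Set (EuclideanSpace ℝ (Fin N))}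
    (hE : IsCompact E) (hU : IsUPC E) {p : ℝ} (hp : 1 ≤ p) :
    markovExponent (fun P : MvPolynomial (Fin N) 𝕜 => supNorm E P) ≤
      markovExponent (fun P : MvPolynomial (Fin N) 𝕜 => lpNormOn E p P) := by
  have hp0 : 0 < p := one_pos.trans_le hp
  obtain ⟨a, ha, h⟩ := hU.exists_degreeDominated_supNorm_lpNormOn (𝕜 := 𝕜) hE hp
  -- Neither definiteness of the sup norm nor the triangle inequality in `L^p` is needed here, so an
  -- empty `E` requires no separate treatment.
  have heq := asymptoticExponent_eq_markovExponent (isPowMul_supSeminorm (𝕜 := 𝕜) hE)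
    (lpNormOn_zero E hp0) (lpNormOn_nonneg E p) ha le_rfl h
    (degreeDominated_lpNormOn_supNorm hE hp0)
  exact heq.symm.trans_le (asymptoticExponent_le_markovExponent (lpNormOn_nonneg E p))

end Nikolskii

end MarkovExp

theorem mainTheorem3 {𝕜 : Type*} [RCLike 𝕜] (N : ℕ) :
    -- a)
    (∀ q σ : Seminorm 𝕜 (MvPolynomial (Fin N) 𝕜), MarkovExp.HasGNP q σ →
      (MarkovExp.asymptoticExponent q = MarkovExp.markovExponent q ↔
        MarkovExp.markovExponent q = MarkovExp.markovExponent σ)) ∧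
    -- b)
    (∀ q σ : Seminorm 𝕜 (MvPolynomial (Fin N) 𝕜), MarkovExp.HasGNP q σ →
      MarkovExp.markovExponent σ ≠ ∞ →
      MarkovExp.MarkovInequality q (MarkovExp.markovExponent σ).toReal →
      (∀ s : ℝ, 0 ≤ s → s < (MarkovExp.markovExponent σ).toReal →
        ¬ MarkovExp.MarkovInequality q s) ∧
      MarkovExp.markovExponent q = MarkovExp.markovExponent σ) ∧
    -- c)
    (∀ E : Set (EuclideanSpace ℝ (Fin N)), IsCompact E → MarkovExp.IsUPC E →
      ∀ p : ℝ, 1 ≤ p →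
        MarkovExp.markovExponent (fun P : MvPolynomial (Fin N) 𝕜 => MarkovExp.supNorm E P) ≤
          MarkovExp.markovExponent
            (fun P : MvPolynomial (Fin N) 𝕜 => MarkovExp.lpNormOn E p P)) :=
  ⟨fun _ _ h => h.asymptoticExponent_eq_markovExponent_iff,
    fun _ _ h hσ hM => ⟨fun _ hs hlt => h.not_markovInequality_of_lt hs hlt,
      h.markovExponent_eq hσ hM⟩,
    fun _ hE hU _ hp => hU.markovExponent_supNorm_le hE hp⟩
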